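/- Let $\Gamma=\mathbb Z[Q_1,Q_2,\dots]/(Q_k^2+2\sum_{j=1}^k(-1)^jQ_{k+j}Q_{k-j},\ k\ge 1)$ with $Q_0=1$, and $\Gamma'=\mathbb Z[P_1,P_2,\dots]/(P_k^2+2\sum_{j=1}^{k-1}(-1)^jP_{k+j}P_{k-j}+(-1)^kP_{2k},\ k\ge 1)$. Let $t=(t_1,t_2,\dots)$ be indeterminates. Put $Q=1+Q_1+Q_2+\cdots$ in $\Gamma$; in $\Gamma'$ put $Q=1+2P_1+2P_2+\cdots$. A subscript $p$ on a series denotes its term of degree $p$, where $Q_i$, $P_i$ have degree $i$ and $t_j$ has degree $1$. For $k\ge 0$ let $q(k)=Q\cdot\prod_{j=1}^{k-1}(1+t_j)$ (so $q(0)=Q$) and, for $k,l\ge 0$, $$\mathbb Q_k=q(k)_k,\qquad \mathbb Q_{k\,l}=q(k)_kq(l)_l+2\sum_{j=1}^l(-1)^jq(k)_{k+j}q(l)_{l-j}\in\Gamma[t].$$ For a strict partition $\lambda=(\lambda_1>\dots>\lambda_r>0)$ let $\mathbb Q_\lambda\in\Gamma[t]$ be the Pfaffian of the skew-symmetric matrix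 $(\mathbb Q_{\lambda_i\,\lambda_j})$ if $r$ is even, and $\mathbb Q_\lambda=\sum_{k=1}^r(-1)^{k-1}\mathbb Q_{\lambda_k}\mathbb Q_{(\lambda_1,\dots,\widehat{\lambda_k},\dots,\lambda_r)}$ if $r$ is odd. For $k\ge 0$ let $e(k)=\prod_{i=1}^k(1+t_i)$, $r(k)=Q\cdot e(k)$ and, for $k,l\ge0$, $$\mathbb R_{k\,l}=\tfrac14\Bigl((r(k)_k-e(k)_k)(r(l)_l+e(l)_l)+2\sum_{j=1}^l(-1)^jr(k)_{k+j}r(l)_{l-j}\Bigr)\in\Gamma'[t],$$ where the division by $4$ is the canonical one obtained by writing everything in terms of the $P_i$. For a sequence $\lambda=(\lambda_1>\dots>\lambda_r\ge 0)$ of even length $r$ let $\mathbb R_\lambda\in\Gamma'[t]$ be the Pfaffian of the skew-symmetric matrix $(\mathbb R_{\lambda_i\,\lambda_j})$. For a strict partition $\lambda$ of length $r\le n$ and a sequence $a=(a_1,a_2,\dots)$, Ivanov's factorial $P$- and $Q$-functions in $n$ variables are $$P^{(n)}_\lambda(x_1,\dots,x_n|a)=\frac1{(n-r)!}\sum_{w\in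 S_n}w\Bigl(\prod_{i=1}^r(x_i-a_1)\cdots(x_i-a_{\lambda_i})\prod_{i\le r,\ i<j\le n}\frac{x_i+x_j}{x_i-x_j}\Bigr),$$ $$Q^{(n)}_\lambda(x_1,\dots,x_n|a)=2^rP^{(n)}_\lambda(x_1,\dots,x_n|0,a_1,a_2,\dots),$$ where $w\in S_n$ permutes the variables $x_i$. The functions $Q_\lambda(x|-t)$ and $P_\lambda(x|-t)$ of Ikeda–Mihalcea–Naruse are the stable limits, with $a=-t$, of $Q^{(n)}_\lambda$ as $n\to\infty$, and of $P^{(n)}_\lambda$ as $n\to\infty$ through even $n$. Regard $\Gamma$ and $\Gamma'$ as rings of symmetric functions in $x_1,x_2,\dots$ by $\sum_kQ_ku^k=\prod_i\frac{1+x_iu}{1-x_iu}$ and $P_k=\frac12Q_k$ $(k\ge1)$. Then: 1. For every strict partition $\lambda$, $\mathbb Q_\lambda=Q_\lambda(x|-t)$. Explicitly, for every $n\ge r$, where $r$ is the length of $\lambda$, the restriction of $\mathbb Q_\lambda$ to the variables $x_1,\dots,x_n$ (that is, its image under $\sum_kQ_ku^k\mapsto\prod_{i=1}^n\frac{1+x_iu}{1-x_iu}$,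 $t_j\mapsto t_j$) is $Q^{(n)}_\lambda(x_1,\dots,x_n|-t)$. 2. For every sequence $\lambda=(\lambda_1>\dots>\lambda_r\ge0)$ of even length, with underlying strict partition $\mu$ (drop the last part if it is $0$), $\mathbb R_\lambda=P_\mu(x|-t)$. Explicitly, for every even $n$ not less than the length of $\mu$, the restriction of $\mathbb R_\lambda$ to $x_1,\dots,x_n$ is $P^{(n)}_\mu(x_1,\dots,x_n|-t)$. -/

import Mathlib

/-! ### The rings `Γ` and `Γ'` -/

/-- The generators `Q_0 = 1, Q_1, Q_2, …` (or `P_0 = 1, P_1, P_2, …`) of the polynomial ring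
`ℤ[Q_1, Q_2, …]`; the variable `X i` stands for `Q_{i+1}`. -/
noncomputable def gen : ℕ → MvPolynomial ℕ ℤ
  | 0 => 1
  | k + 1 => MvPolynomial.X k

/-- `Q_k² + 2 ∑_{j=1}^{k} (-1)^j Q_{k+j} Q_{k-j}`. -/
noncomputable def relC (k : ℕ) : MvPolynomial ℕ ℤ :=
  gen k ^ 2 + 2 * ∑ j ∈ Finset.Icc 1 k, (-1) ^ j * gen (k + j) * gen (k - j)

/-- `P_k² + 2 ∑_{j=1}^{k-1} (-1)^j P_{k+j} P_{k-j} + (-1)^k P_{2k}`. -/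
noncomputable def relD (k : ℕ) : MvPolynomial ℕ ℤ :=
  gen k ^ 2 + 2 * ∑ j ∈ Finset.Icc 1 (k - 1), (-1) ^ j * gen (k + j) * gen (k - j)
    + (-1) ^ k * gen (2 * k)

/-- The ideal of relations of `Γ`, generated by `relC k` for `k ≥ 1`. -/
noncomputable def idealC : Ideal (MvPolynomial ℕ ℤ) :=
  Ideal.span {f | ∃ k : ℕ, 1 ≤ k ∧ f = relC k}

/-- The ideal of relations of `Γ'`, generated by `relD k` for `k ≥ 1`. -/
noncomputable def idealD : Ideal (MvPolynomial ℕ ℤ) :=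
  Ideal.span {f | ∃ k : ℕ, 1 ≤ k ∧ f = relD k}

/-- `Γ = ℤ[Q_1, Q_2, …] / (Q_k² + 2 ∑_{j=1}^k (-1)^j Q_{k+j} Q_{k-j}, k ≥ 1)`. -/
abbrev Gam : Type := MvPolynomial ℕ ℤ ⧸ idealC

/-- `Γ' = ℤ[P_1, P_2, …] / (P_k² + 2 ∑_{j=1}^{k-1} (-1)^j P_{k+j} P_{k-j} + (-1)^k P_{2k}, k ≥ 1)`.
-/
abbrev GamD : Type := MvPolynomial ℕ ℤ ⧸ idealD

/-- `Q_k ∈ Γ`, with `Q_0 = 1`. -/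
noncomputable def Qgen (k : ℕ) : Gam := Ideal.Quotient.mk idealC (gen k)

/-- `P_k ∈ Γ'`, with `P_0 = 1`. -/
noncomputable def Pgen (k : ℕ) : GamD := Ideal.Quotient.mk idealD (gen k)

/-! ### Pfaffians -/

/-- The Pfaffian of a skew-symmetric matrix, by Laplace expansion along the first row. -/
noncomputable def pfaffian {R : Type*} [CommRing R] :
    (n : ℕ) → Matrix (Fin n) (Fin n) R → R
  | 0, _ => 1
  | 1, _ => 0
  | n + 2, A => ∑ k : Fin (n + 1), (-1) ^ (k : ℕ) * A 0 k.succ *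
      pfaffian n (A.submatrix (fun i => (k.succAbove i).succ) (fun i => (k.succAbove i).succ))

/-- The Pfaffian of an `r × r` skew-symmetric matrix `A` for which elements `m_1, …, m_r` are also
given: the usual one for even `r`, and `∑_k (-1)^{k-1} m_k Pf(A_k)` for odd `r`, where `A_k` is `A`
without its `k`th row and column. -/
noncomputable def pfaffianExt {R : Type*} [CommRing R] :
    (r : ℕ) → Matrix (Fin r) (Fin r) R → (Fin r → R) → R
  | 0, _, _ => 1
  | r + 1, A, m =>
      if Even (r + 1) then pfaffian (r + 1) A
      else ∑ k : Fin (r + 1), (-1) ^ (k : ℕ) * m k *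
        pfaffian r (A.submatrix k.succAbove k.succAbove)

/-! ### The multivariate polynomials of type C, in `Γ[t] = Γ[t_1, t_2, …]`

The variable `X j` of `MvPolynomial ℕ Γ` is `t_{j+1}`. A sequence `c = c_0 + c_1 + c_2 + ⋯` is the
power series `∑ c_p u^p` in an auxiliary grading variable `u`. -/

/-- `∏_{j=1}^{k} (1 + t_j u)`, whose `u^i`-coefficient is `e_i(t_1, …, t_k)`. -/
noncomputable def elemSeries (R : Type*) [CommRing R] (k : ℕ) :
    PowerSeries (MvPolynomial ℕ R) :=
  ∏ j ∈ Finset.range k, (1 + PowerSeries.C (MvPolynomial.X j) * PowerSeries.X)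

/-- `q(k) = Q · ∏_{j=1}^{k-1} (1 + t_j)` (so `q(0) = Q`). -/
noncomputable def qSeries (k : ℕ) : PowerSeries (MvPolynomial ℕ Gam) :=
  PowerSeries.mk (fun p => MvPolynomial.C (Qgen p)) * elemSeries Gam (k - 1)

/-- `q(k)_p`. -/
noncomputable def q (k p : ℕ) : MvPolynomial ℕ Gam := PowerSeries.coeff p (qSeries k)

/-- `ℚ_{k l} = q(k)_k q(l)_l + 2 ∑_{j=1}^{l} (-1)^j q(k)_{k+j} q(l)_{l-j}`. -/
noncomputable def QQ2 (k l : ℕ) : MvPolynomial ℕ Gam :=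
  q k k * q l l + 2 * ∑ j ∈ Finset.Icc 1 l, (-1) ^ j * q k (k + j) * q l (l - j)

/-- `ℚ_λ`: the Pfaffian of the matrix `(ℚ_{λ_i λ_j})`, with `ℚ_k = q(k)_k` for odd length. -/
noncomputable def QQ (lam : List ℕ) : MvPolynomial ℕ Gam :=
  pfaffianExt lam.length (Matrix.of fun i j => QQ2 (lam.get i) (lam.get j))
    (fun i => q (lam.get i) (lam.get i))

/-! ### The multivariate polynomials of type D, in `Γ'[t]` -/

/-- `e(k)_p = e_p(t_1, …, t_k)`. -/
noncomputable def eD (k p : ℕ) : MvPolynomial ℕ GamD :=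
  PowerSeries.coeff p (elemSeries GamD k)

/-- `r(k) = Q · ∏_{i=1}^{k} (1 + t_i)`, where `Q = 1 + 2 P_1 + 2 P_2 + ⋯`. -/
noncomputable def rSeries (k : ℕ) : PowerSeries (MvPolynomial ℕ GamD) :=
  PowerSeries.mk (fun p => MvPolynomial.C (if p = 0 then 1 else 2 * Pgen p)) * elemSeries GamD k

/-- `r(k)_p`. -/
noncomputable def rD (k p : ℕ) : MvPolynomial ℕ GamD := PowerSeries.coeff p (rSeries k)

/-- `P_p + e(k)_1 P_{p-1} + e(k)_2 P_{p-2} + ⋯ + e(k)_{p-1} P_1`,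
which is `(r(k)_p - e(k)_p) / 2`. -/
noncomputable def hD (k p : ℕ) : MvPolynomial ℕ GamD :=
  ∑ i ∈ Finset.range p, eD k i * MvPolynomial.C (Pgen (p - i))

/-- The two-index polynomial of type D in its explicit form without denominators,
`(P_k + e(k)_1 P_{k-1} + ⋯ + e(k)_{k-1} P_1) (P_l + e(l)_1 P_{l-1} + ⋯ + e(l)_l)`
`+ ∑_{j=1}^{l} (-1)^j (P_{k+j} + ⋯ + e(k)_k P_j) (2 P_{l-j} + 2 e(l)_1 P_{l-j-1} + ⋯ + e(l)_{l-j})`.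
-/
noncomputable def RR2 (k l : ℕ) : MvPolynomial ℕ GamD :=
  hD k k * (hD l l + eD l l) + ∑ j ∈ Finset.Icc 1 l, (-1) ^ j * hD k (k + j) * rD l (l - j)

/-- `r(k) = e(k) + 2 h(k)` in each degree. -/
theorem rD_eq (k p : ℕ) : rD k p = 2 * hD k p + eD k p := by
  have h : (PowerSeries.mk fun p => (MvPolynomial.C (if p = 0 then (1 : GamD) else 2 * Pgen p) :
      MvPolynomial ℕ GamD)) = 1 + PowerSeries.C 2 *
        PowerSeries.mk (fun p => MvPolynomial.C (if p = 0 then (0 : GamD) else Pgen p)) := by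
    ext1 m
    rw [map_add, PowerSeries.coeff_C_mul, PowerSeries.coeff_mk, PowerSeries.coeff_mk,
      PowerSeries.coeff_one]
    split_ifs
    · simp
    · rw [map_mul, zero_add, map_ofNat]
  rw [rD, rSeries, h, add_mul, one_mul, map_add, mul_assoc, PowerSeries.coeff_C_mul, add_comm, eD]
  congr 2
  rw [mul_comm, PowerSeries.coeff_mul, Finset.Nat.sum_antidiagonal_eq_sum_range_succ_mk,
    Finset.sum_range_succ, hD]
  simp only [PowerSeries.coeff_mk, Nat.sub_self, if_true, map_zero, mul_zero, add_zero]
  refine Finset.sum_congr rfl fun i hi => ?_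
  rw [if_neg (by have := Finset.mem_range.1 hi; omega), eD]

theorem elemSeries_coeff_eq_zero (R : Type*) [CommRing R] (k p : ℕ) (h : k < p) :
    PowerSeries.coeff p (elemSeries R k) = 0 := by
  induction k generalizing p with
  | zero => simp [elemSeries, PowerSeries.coeff_one, show p ≠ 0 by omega]
  | succ k ih =>
    obtain ⟨p, rfl⟩ : ∃ m, p = m + 1 := ⟨p - 1, by omega⟩
    have e : elemSeries R (k + 1) = elemSeries R k +
        PowerSeries.C (MvPolynomial.X k) * elemSeries R k * PowerSeries.X := by
      rw [elemSeries, Finset.prod_range_succ, ← elemSeries]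
      ring
    rw [e, map_add, PowerSeries.coeff_succ_mul_X, PowerSeries.coeff_C_mul, ih _ (by omega),
      ih _ (by omega)]
    simp

/-- The two-index polynomial of type D is `1/4` of
`(r(k)_k - e(k)_k) (r(l)_l + e(l)_l) + 2 ∑_{j=1}^{l} (-1)^j r(k)_{k+j} r(l)_{l-j}`. -/
theorem four_mul_RR2 (k l : ℕ) :
    4 * RR2 k l = (rD k k - eD k k) * (rD l l + eD l l) +
      2 * ∑ j ∈ Finset.Icc 1 l, (-1) ^ j * rD k (k + j) * rD l (l - j) := by
  have e : ∀ j ∈ Finset.Icc 1 l, (-1) ^ j * rD k (k + j) * rD l (l - j) =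
      2 * ((-1) ^ j * hD k (k + j) * rD l (l - j)) := by
    intro j hj
    have hj' := Finset.mem_Icc.1 hj
    rw [rD_eq k, eD, elemSeries_coeff_eq_zero _ _ _ (by omega)]
    ring
  rw [Finset.sum_congr rfl e, ← Finset.mul_sum, RR2, rD_eq k k, rD_eq l l]
  ring

/-- `ℝ_λ` for a partition `λ` of type D of even length: the Pfaffian of `(ℝ_{λ_i λ_j})`. -/
noncomputable def RR (lam : List ℕ) : MvPolynomial ℕ GamD :=
  pfaffian lam.length (Matrix.of fun i j => RR2 (lam.get i) (lam.get j))

/-! ### Partitions -/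

/-- Strict partitions `λ_1 > ⋯ > λ_r > 0` (the empty one included). -/
def IsStrictPartition (lam : List ℕ) : Prop :=
  lam.Pairwise (· > ·) ∧ ∀ a ∈ lam, 0 < a

/-- Partitions of type D: `λ_1 > ⋯ > λ_r ≥ 0`. -/
def IsTypeDPartition (lam : List ℕ) : Prop :=
  lam.Pairwise (· > ·)

/-- The strict partition underlying a partition of type D (a possible last part `0` is dropped). -/
def underlying (lam : List ℕ) : List ℕ := lam.filter (0 < ·)

/-! ### The factorial `P`- and `Q`-functions of Ivanov, in `n` variables -/

/-- Ivanov's factorial `P`-function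
`P_λ^{(n)}(x_1, …, x_n | a) = 1/(n-r)! ∑_{w ∈ S_n} w (∏_{i=1}^r (x_i|a)^{λ_i}`
`∏_{i ≤ r, i < j ≤ n} (x_i + x_j)/(x_i - x_j))`, where `(y|a)^k = (y - a_1) ⋯ (y - a_k)`, `r ≤ n` is
the length of `λ`, and `S_n` permutes `x_1, …, x_n`. Here `a i` stands for `a_{i+1}`. -/
noncomputable def factorialP {K : Type*} [Field K] (n : ℕ) (x : Fin n → K) (a : ℕ → K)
    (lam : List ℕ) : K :=
  (((n - lam.length).factorial : ℕ) : K)⁻¹ * ∑ w : Equiv.Perm (Fin n),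
    ∏ i ∈ Finset.univ.filter (fun i : Fin n => (i : ℕ) < lam.length),
      ((∏ m ∈ Finset.range (lam.getD i 0), (x (w i) - a m)) *
        ∏ j ∈ Finset.Ioi i, (x (w i) + x (w j)) / (x (w i) - x (w j)))

/-- The sequence `0, a_1, a_2, …`. -/
def shiftZero {K : Type*} [Zero K] (a : ℕ → K) : ℕ → K
  | 0 => 0
  | m + 1 => a m

/-- The factorial `Q`-function `Q_λ^{(n)}(x | a) = 2^r P_λ^{(n)}(x | 0, a)`. -/
noncomputable def factorialQ {K : Type*} [Field K] (n : ℕ) (x : Fin n → K) (a : ℕ → K)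
    (lam : List ℕ) : K :=
  2 ^ lam.length * factorialP n x (shiftZero a) lam

/-! ### `Γ` and `Γ'` as rings of symmetric functions -/

/-- `∏_{i=1}^{n} (1 + x_i u)/(1 - x_i u)`. -/
noncomputable def schurSeries {R : Type*} [CommRing R] {n : ℕ} (x : Fin n → R) : PowerSeries R :=
  ∏ i, ((1 + PowerSeries.C (x i) * PowerSeries.X) *
    PowerSeries.invOfUnit (1 - PowerSeries.C (x i) * PowerSeries.X) 1)

/-- Schur's `Q_k(x_1, …, x_n)`, the coefficient of `u^k` in `∏ (1 + x_i u)/(1 - x_i u)`. -/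
noncomputable def schurQ {R : Type*} [CommRing R] {n : ℕ} (x : Fin n → R) (k : ℕ) : R :=
  PowerSeries.coeff k (schurSeries x)

theorem schurQ_zero {R : Type*} [CommRing R] {n : ℕ} (x : Fin n → R) : schurQ x 0 = 1 := by
  simp [schurQ, schurSeries, map_prod]

theorem schurSeries_mul_neg {R : Type*} [CommRing R] {n : ℕ} (x : Fin n → R) :
    schurSeries x * PowerSeries.evalNegHom (schurSeries x) = 1 := by
  unfold schurSeries
  rw [map_prod, ← Finset.prod_mul_distrib]
  refine Finset.prod_eq_one fun i _ => ?_
  have hX : PowerSeries.evalNegHom (PowerSeries.X : PowerSeries R) = -PowerSeries.X :=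
    PowerSeries.evalNegHom_X
  have hC : PowerSeries.evalNegHom (PowerSeries.C (x i)) = PowerSeries.C (x i) := by
    ext m
    rw [PowerSeries.evalNegHom, PowerSeries.coeff_rescale, PowerSeries.coeff_C]
    split_ifs with h <;> simp [h]
  have h1 : (1 - PowerSeries.C (x i) * PowerSeries.X) *
      PowerSeries.invOfUnit (1 - PowerSeries.C (x i) * PowerSeries.X) 1 = 1 :=
    PowerSeries.mul_invOfUnit _ _ (by simp)
  have h2 := congrArg PowerSeries.evalNegHom h1
  simp only [map_mul, map_sub, map_add, map_one, hX, hC] at h2 ⊢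
  linear_combination (h2 * (1 : PowerSeries R)) +
    (1 + PowerSeries.C (x i) * PowerSeries.X) * PowerSeries.evalNegHom
      (PowerSeries.invOfUnit (1 - PowerSeries.C (x i) * PowerSeries.X) 1) * h1

/-- The relations of `Γ` hold for the `Q_k(x_1, …, x_n)`. -/
theorem schurQ_rel {R : Type*} [CommRing R] {n : ℕ} (x : Fin n → R) (k : ℕ) (hk : 1 ≤ k) :
    schurQ x k ^ 2 +
      2 * ∑ j ∈ Finset.Icc 1 k, (-1) ^ j * schurQ x (k + j) * schurQ x (k - j) = 0 := by
  have h := congrArg (PowerSeries.coeff (2 * k)) (schurSeries_mul_neg x)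
  rw [PowerSeries.coeff_mul, PowerSeries.coeff_one, if_neg (by omega),
    Finset.Nat.sum_antidiagonal_eq_sum_range_succ_mk] at h
  have hc : ∀ m, PowerSeries.coeff m (PowerSeries.evalNegHom (schurSeries x)) =
      (-1) ^ m * schurQ x m := by
    intro m
    rw [PowerSeries.evalNegHom, PowerSeries.coeff_rescale, schurQ]
  simp only [hc] at h
  change ∑ i ∈ Finset.range (2 * k + 1),
    schurQ x i * ((-1) ^ (2 * k - i) * schurQ x (2 * k - i)) = 0 at h
  rw [show 2 * k + 1 = (k + 1) + k by omega, Finset.sum_range_add, Finset.sum_range_succ,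
    ← Finset.sum_range_reflect] at h
  have e1 : ∀ j ∈ Finset.range k, schurQ x (k - 1 - j) *
      ((-1) ^ (2 * k - (k - 1 - j)) * schurQ x (2 * k - (k - 1 - j))) =
      (-1) ^ k * ((-1) ^ (1 + j) * schurQ x (k + (1 + j)) * schurQ x (k - (1 + j))) := by
    intro j hj
    have hj' := Finset.mem_range.1 hj
    rw [show 2 * k - (k - 1 - j) = k + (1 + j) by omega,
      show k - 1 - j = k - (1 + j) by omega, pow_add]
    ring
  have e2 : ∀ j ∈ Finset.range k, schurQ x (k + 1 + j) *
      ((-1) ^ (2 * k - (k + 1 + j)) * schurQ x (2 * k - (k + 1 + j))) =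
      (-1) ^ k * ((-1) ^ (1 + j) * schurQ x (k + (1 + j)) * schurQ x (k - (1 + j))) := by
    intro j hj
    have hj' := Finset.mem_range.1 hj
    have hs : ((-1 : R)) ^ (k - (1 + j)) = (-1) ^ k * (-1) ^ (1 + j) := by
      rw [← pow_add, show k + (1 + j) = (k - (1 + j)) + 2 * (1 + j) by omega, pow_add, pow_mul]
      simp
    rw [show 2 * k - (k + 1 + j) = k - (1 + j) by omega,
      show k + 1 + j = k + (1 + j) by omega, hs]
    ring
  rw [Finset.sum_congr rfl e1, Finset.sum_congr rfl e2, ← Finset.mul_sum,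
    show 2 * k - k = k by omega] at h
  have h3 : ∑ j ∈ Finset.Icc 1 k, (-1) ^ j * schurQ x (k + j) * schurQ x (k - j) =
      ∑ j ∈ Finset.range k,
        (-1) ^ (1 + j) * schurQ x (k + (1 + j)) * schurQ x (k - (1 + j)) := by
    rw [← Finset.Ico_add_one_right_eq_Icc, Finset.sum_Ico_eq_sum_range]
    simp
  rw [h3]
  have h4 : ((-1 : R) ^ k) * (-1) ^ k = 1 := by
    rw [← mul_pow]
    simp
  linear_combination (-1) ^ k * h - (schurQ x k ^ 2 +
      2 * ∑ j ∈ Finset.range k,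
        (-1) ^ (1 + j) * schurQ x (k + (1 + j)) * schurQ x (k - (1 + j))) * h4

/-- The values of the generators determine a ring homomorphism; `X i` stands for `Q_{i+1}`. -/
theorem eval_gen {R : Type*} [CommRing R] (f : ℕ → R) (hf : f 0 = 1) (k : ℕ) :
    MvPolynomial.eval₂Hom (Int.castRingHom R) (fun i => f (i + 1)) (gen k) = f k := by
  cases k <;> simp [gen, hf]

/-- The homomorphism `Γ → R`, `Q_k ↦ Q_k(x_1, …, x_n)`. -/
noncomputable def symC {R : Type*} [CommRing R] {n : ℕ} (x : Fin n → R) : Gam →+* R :=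
  Ideal.Quotient.lift idealC
    (MvPolynomial.eval₂Hom (Int.castRingHom R) (fun i => schurQ x (i + 1))) (by
      intro a ha
      have h : idealC ≤ RingHom.ker
          (MvPolynomial.eval₂Hom (Int.castRingHom R) (fun i => schurQ x (i + 1))) := by
        refine Ideal.span_le.2 ?_
        rintro f ⟨k, hk, rfl⟩
        have := schurQ_rel x k hk
        simp only [SetLike.mem_coe, RingHom.mem_ker, relC, map_add, map_mul, map_pow, map_sum,
          map_neg, map_one, map_ofNat, eval_gen (schurQ x) (schurQ_zero x)]
        exact this
      exact h ha)

/-- The values of the `P_k`: `P_0 = 1` and `P_k(x_1, …, x_n) = Q_k(x_1, …, x_n) / 2` for `k ≥ 1`. -/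
noncomputable def schurP {K : Type*} [Field K] {n : ℕ} (x : Fin n → K) (k : ℕ) : K :=
  if k = 0 then 1 else schurQ x k / 2

theorem schurP_rel {K : Type*} [Field K] [CharZero K] {n : ℕ} (x : Fin n → K) (k : ℕ)
    (hk : 1 ≤ k) :
    schurP x k ^ 2 +
      2 * ∑ j ∈ Finset.Icc 1 (k - 1), (-1) ^ j * schurP x (k + j) * schurP x (k - j)
      + (-1) ^ k * schurP x (2 * k) = 0 := by
  obtain ⟨m, rfl⟩ : ∃ m, k = m + 1 := ⟨k - 1, by omega⟩
  have h := schurQ_rel x (m + 1) hk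
  rw [Finset.sum_Icc_succ_top (by omega), Nat.sub_self, schurQ_zero] at h
  have e : ∀ j ∈ Finset.Icc 1 m, (-1) ^ j * schurP x (m + 1 + j) * schurP x (m + 1 - j) =
      ((-1) ^ j * schurQ x (m + 1 + j) * schurQ x (m + 1 - j)) / 4 := by
    intro j hj
    have hj' := Finset.mem_Icc.1 hj
    rw [schurP, schurP, if_neg (by omega), if_neg (by omega)]
    ring
  rw [Nat.add_sub_cancel, Finset.sum_congr rfl e, ← Finset.sum_div, schurP, schurP,
    if_neg (by omega), if_neg (by omega), show 2 * (m + 1) = m + 1 + (m + 1) by omega]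
  linear_combination h / 4

/-- The homomorphism `Γ' → K`, `P_k ↦ P_k(x_1, …, x_n)`. -/
noncomputable def symD {K : Type*} [Field K] [CharZero K] {n : ℕ} (x : Fin n → K) : GamD →+* K :=
  Ideal.Quotient.lift idealD
    (MvPolynomial.eval₂Hom (Int.castRingHom K) (fun i => schurP x (i + 1))) (by
      intro a ha
      have h : idealD ≤ RingHom.ker
          (MvPolynomial.eval₂Hom (Int.castRingHom K) (fun i => schurP x (i + 1))) := by
        refine Ideal.span_le.2 ?_
        rintro f ⟨k, hk, rfl⟩
        have := schurP_rel x k hk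
        simp only [SetLike.mem_coe, RingHom.mem_ker, relD, map_add, map_mul, map_pow, map_sum,
          map_neg, map_one, map_ofNat, eval_gen (schurP x) (by simp [schurP])]
        exact this
      exact h ha)

/-- The field `ℚ(t_1, t_2, …)(x_1, …, x_n)`, as the fraction field of `ℤ[t_1, t_2, …][x_1, …, x_n]`.
-/
abbrev RatXT (n : ℕ) : Type := FractionRing (MvPolynomial (Fin n) (MvPolynomial ℕ ℤ))

/-- The variable `x_{i+1}`. -/
noncomputable def xv (n : ℕ) (i : Fin n) : RatXT n :=
  algebraMap (MvPolynomial (Fin n) (MvPolynomial ℕ ℤ)) (RatXT n) (MvPolynomial.X i)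

/-- The variable `t_{j+1}`. -/
noncomputable def tv (n : ℕ) (j : ℕ) : RatXT n :=
  algebraMap (MvPolynomial (Fin n) (MvPolynomial ℕ ℤ)) (RatXT n)
    (MvPolynomial.C (MvPolynomial.X j))

/-- The realization of `Γ[t]` by symmetric functions, restricted to the variables `x_1, …, x_n`:
`Q ↦ ∏_{i=1}^{n} (1 + x_i)/(1 - x_i)` and `t_j ↦ t_j`. -/
noncomputable def realizeC (n : ℕ) : MvPolynomial ℕ Gam →+* RatXT n :=
  MvPolynomial.eval₂Hom (symC (xv n)) (tv n)

/-- The realization of `Γ'[t]` by symmetric functions, restricted to `x_1, …, x_n`: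
`P_k ↦ Q_k(x_1, …, x_n) / 2` and `t_j ↦ t_j`. -/
noncomputable def realizeD (n : ℕ) : MvPolynomial ℕ GamD →+* RatXT n :=
  MvPolynomial.eval₂Hom (symD (xv n)) (tv n)

/-! Both sides are brought to one expression: a sum over all maps σ from positions to variables of
`∏ φ_i(σ_i)` times Schur's product `∏_{i<j} (x_{σ_j} - x_{σ_i})/(x_{σ_j} + x_{σ_i})`, called
`skewSum`.

Polynomial side. With `g_p = ∏_{i≠p} (x_p + x_i)/(x_p - x_i)`, partial fractions give `∏ (1 + x_i
u)/(1 - x_i u) = (-1)^n + ∑_p 2 g_p/(1 - x_p u)` (`coeff_prod_schur`). Hence, apart from the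
constant `(-1)^n`, the coefficients of `q(k)` and `r(k)` in degree `k+j` are sums `∑_p f_p x_p^j`.
Substituting this for the first factor of a two-index polynomial turns the alternating sum over `j`
into one coefficient of the second series multiplied by `(1 - x_p u)/(1 + x_p u) = 1 + 2 ∑_{j≥1}
(-x_p u)^j`. That multiplication replaces `g_q` by `g_q (x_q - x_p)/(x_q + x_p)`, so the two-index
polynomials are values of the skew form `skewForm` (`realizeC_QQ2`, `realizeD_RR2`). Schur's
Pfaffian identity then evaluates the Pfaffian as a `skewSum` (`pfaffian_skewForm`); the odd-length
convention is the same identity with an extra variable equal to 0 (`skewSum_odd`).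

Symmetric function side. Ivanov's summand depends only on the images of the first `r` positions:
completing its product to the full weights `g` leaves exactly Schur's product, and `1/(n-r)!` counts
the extensions to a permutation (`factorialP_eq_skewSum`).

In type D a part 0 contributes the function `g` itself, and for even `n` summing it out gives the
factor 1 (`skewSum_snoc_pfWeight`). -/

/-! ### Partial fractions -/

section PartialFractions

variable {K ι : Type*} [Field K] [DecidableEq ι]

/-- `∏_{i ∈ S, i ≠ k} (x_k + x_i)/(x_k - x_i)`. -/
def pfWeight (S : Finset ι) (x : ι → K) (k : ι) : K :=
  ∏ i ∈ S.erase k, (x k + x i) / (x k - x i)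

theorem pfWeight_insert_self (S : Finset ι) (x : ι → K) {m : ι} (hm : m ∉ S) :
    pfWeight (insert m S) x m = ∏ i ∈ S, (x m + x i) / (x m - x i) := by
  rw [pfWeight, Finset.erase_insert hm]

theorem pfWeight_insert_of_mem (S : Finset ι) (x : ι → K) {m k : ι} (hm : m ∉ S) (hk : k ∈ S) :
    pfWeight (insert m S) x k = (x k + x m) / (x k - x m) * pfWeight S x k := by
  have hmk : m ≠ k := fun h => hm (h ▸ hk)
  rw [pfWeight, Finset.erase_insert_of_ne hmk, Finset.prod_insert (by simp [hm]), pfWeight]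

/-- Partial fractions in `y`: the residues at `y = -x_k` agree, and the constant is the formal value
at `y = 0`. -/
theorem prod_sub_div_add_eq (S : Finset ι) (x : ι → K) (hx : Set.InjOn x S) (y : K)
    (hy : ∀ k ∈ S, y + x k ≠ 0) :
    ∏ k ∈ S, (y - x k) / (y + x k) =
      (-1) ^ S.card + ∑ k ∈ S, 2 * pfWeight S x k * (y / (y + x k)) := by
  induction S using Finset.induction_on generalizing y with
  | empty => simp
  | insert m S hm ih =>
    have hS : Set.InjOn x S := hx.mono (by simp)
    have hne : ∀ k ∈ S, x k - x m ≠ 0 := fun k hk h => hm (by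
      have := hx (by simp [hk]) (by simp) (sub_eq_zero.1 h)
      exact this ▸ hk)
    have hym : y + x m ≠ 0 := hy m (by simp)
    have h1 := ih hS y fun k hk => hy k (by simp [hk])
    -- The induction hypothesis at `y = -x_m` computes the weight of the new pole; this is why `y`
    -- is generalized.
    have h2 := ih hS (-x m) fun k hk => by
      rw [neg_add_eq_sub]; exact hne k hk
    have h3 : ∏ k ∈ S, (-x m - x k) / (-x m + x k) = pfWeight (insert m S) x m := by
      rw [pfWeight_insert_self _ _ hm]
      refine Finset.prod_congr rfl fun k hk => ?_
      rw [← neg_div_neg_eq]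
      congr 1 <;> ring
    have h4 : ∑ k ∈ S, 2 * pfWeight (insert m S) x k * (y / (y + x k)) =
        (y - x m) / (y + x m) * ∑ k ∈ S, 2 * pfWeight S x k * (y / (y + x k)) +
        (-2 * y / (y + x m)) * ∑ k ∈ S, 2 * pfWeight S x k * (-x m / (-x m + x k)) := by
      rw [Finset.mul_sum, Finset.mul_sum, ← Finset.sum_add_distrib]
      refine Finset.sum_congr rfl fun k hk => ?_
      rw [pfWeight_insert_of_mem _ _ hm hk, neg_add_eq_sub]
      have := hne k hk
      have := hy k (by simp [hk])
      field_simp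
      ring
    rw [Finset.sum_insert hm, Finset.prod_insert hm, Finset.card_insert_of_notMem hm, h4, h1]
    rw [h3] at h2
    rw [h2]
    field_simp
    ring

/-- Formally the limit `y → ∞` of `prod_sub_div_add_eq`. The sum is therefore 1 for an odd number of
variables and 0 for an even number. -/
theorem two_mul_sum_pfWeight (S : Finset ι) (x : ι → K) (hx : Set.InjOn x S) :
    2 * ∑ k ∈ S, pfWeight S x k = 1 - (-1) ^ S.card := by
  induction S using Finset.induction_on with
  | empty => simp
  | insert m S hm ih =>
    have hS : Set.InjOn x S := hx.mono (by simp)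
    have hne : ∀ k ∈ S, x k - x m ≠ 0 := fun k hk h => hm (by
      have := hx (by simp [hk]) (by simp) (sub_eq_zero.1 h)
      exact this ▸ hk)
    have h2 := prod_sub_div_add_eq S x hS (-x m) fun k hk => by
      rw [neg_add_eq_sub]; exact hne k hk
    have h3 : ∏ k ∈ S, (-x m - x k) / (-x m + x k) = pfWeight (insert m S) x m := by
      rw [pfWeight_insert_self _ _ hm]
      refine Finset.prod_congr rfl fun k hk => ?_
      rw [← neg_div_neg_eq]
      congr 1 <;> ring
    have h4 : ∑ k ∈ S, pfWeight (insert m S) x k = ∑ k ∈ S, pfWeight S x k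
        - ∑ k ∈ S, 2 * pfWeight S x k * (-x m / (-x m + x k)) := by
      rw [← Finset.sum_sub_distrib]
      refine Finset.sum_congr rfl fun k hk => ?_
      rw [pfWeight_insert_of_mem _ _ hm hk, neg_add_eq_sub]
      have := hne k hk
      field_simp
      ring
    rw [Finset.sum_insert hm, Finset.card_insert_of_notMem hm, h4]
    rw [h3] at h2
    linear_combination ih hS + 2 * h2

/-- Partial fractions of `∏ (1 + x_i u)/(1 - x_i u)`, coefficientwise. -/
theorem coeff_prod_schur (S : Finset ι) (x : ι → K) (hx : Set.InjOn x S) (j : ℕ) :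
    PowerSeries.coeff j (∏ i ∈ S, ((1 + PowerSeries.C (x i) * PowerSeries.X) *
      PowerSeries.invOfUnit (1 - PowerSeries.C (x i) * PowerSeries.X) 1)) =
    ∑ k ∈ S, 2 * pfWeight S x k * x k ^ j + if j = 0 then (-1) ^ S.card else 0 := by
  induction S using Finset.induction_on generalizing j with
  | empty => simp [PowerSeries.coeff_one]
  | insert m S hm ih =>
    have hS : Set.InjOn x S := hx.mono (by simp)
    have hne : ∀ k ∈ S, x k - x m ≠ 0 := fun k hk h => hm (by
      have := hx (by simp [hk]) (by simp) (sub_eq_zero.1 h)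
      exact this ▸ hk)
    have hsum := two_mul_sum_pfWeight _ x hx
    rw [Finset.prod_insert hm]
    set A := ∏ i ∈ S, ((1 + PowerSeries.C (x i) * PowerSeries.X) *
      PowerSeries.invOfUnit (1 - PowerSeries.C (x i) * PowerSeries.X) 1) with hA
    set B := (1 + PowerSeries.C (x m) * PowerSeries.X) *
      PowerSeries.invOfUnit (1 - PowerSeries.C (x m) * PowerSeries.X) 1 * A with hB
    have h1 : (1 - PowerSeries.C (x m) * PowerSeries.X) *
      PowerSeries.invOfUnit (1 - PowerSeries.C (x m) * PowerSeries.X) 1 = 1 :=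
      PowerSeries.mul_invOfUnit _ _ (by simp)
    have h2 : B - PowerSeries.C (x m) * (B * PowerSeries.X) =
        A + PowerSeries.C (x m) * (A * PowerSeries.X) := by
      rw [hB]
      linear_combination (1 + PowerSeries.C (x m) * PowerSeries.X) * A * h1
    -- The closed form satisfies the recursion that `h2` imposes on the coefficients of `B`; the
    -- term of `m` drops out on the left.
    have h3 : ∀ j, ∑ k ∈ insert m S, 2 * pfWeight (insert m S) x k * x k ^ (j + 1) -
        x m * ∑ k ∈ insert m S, 2 * pfWeight (insert m S) x k * x k ^ j =
        ∑ k ∈ S, 2 * pfWeight S x k * x k ^ (j + 1) +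
        x m * ∑ k ∈ S, 2 * pfWeight S x k * x k ^ j := by
      intro j
      rw [Finset.sum_insert hm, Finset.sum_insert hm, mul_add, Finset.mul_sum, Finset.mul_sum,
        ← Finset.sum_add_distrib, add_sub_add_comm, ← Finset.sum_sub_distrib,
        show 2 * pfWeight (insert m S) x m * x m ^ (j + 1) -
          x m * (2 * pfWeight (insert m S) x m * x m ^ j) = 0 by ring, zero_add]
      refine Finset.sum_congr rfl fun k hk => ?_
      rw [pfWeight_insert_of_mem _ _ hm hk]
      have := hne k hk
      field_simp
      ring
    rw [Finset.card_insert_of_notMem hm] at *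
    have h0 : PowerSeries.coeff 0 B = 1 := by
      have := congrArg (PowerSeries.coeff 0) h2
      rw [map_sub, map_add, PowerSeries.coeff_C_mul, PowerSeries.coeff_C_mul,
        PowerSeries.coeff_zero_mul_X, PowerSeries.coeff_zero_mul_X, ih hS] at this
      simp only [pow_zero, mul_one, if_true, mul_zero, sub_zero, add_zero] at this
      rw [this, ← Finset.mul_sum, two_mul_sum_pfWeight S x hS]
      ring
    induction j with
    | zero =>
      simp only [pow_zero, mul_one, if_true]
      rw [h0, ← Finset.mul_sum, hsum]
      ring
    | succ j ihj =>
      have := congrArg (PowerSeries.coeff (j + 1)) h2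
      rw [map_sub, map_add, PowerSeries.coeff_C_mul, PowerSeries.coeff_C_mul,
        PowerSeries.coeff_succ_mul_X, PowerSeries.coeff_succ_mul_X, ih hS, ih hS, ihj] at this
      rw [if_neg (Nat.succ_ne_zero j)] at this ⊢
      have h5 := h3 j
      -- For `j = 0` the constants `(-1)^|S|` and `(-1)^(|S|+1)` enter with opposite signs and
      -- cancel.
      split_ifs at this with h
      · linear_combination this - h5
      · linear_combination this - h5

end PartialFractions

/-! ### Schur's Pfaffian -/

section SkewProd

variable {K : Type*} [Field K]

/-- `(b - a)/(b + a)`. -/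
def skewQuot (a b : K) : K := (b - a) / (b + a)

theorem skewQuot_swap (a b : K) : skewQuot a b = -skewQuot b a := by
  rw [skewQuot, skewQuot, add_comm, ← neg_div, neg_sub]

theorem skewQuot_self (a : K) : skewQuot a a = 0 := by simp [skewQuot]

/-- `∏_{i < j} (z_j - z_i)/(z_j + z_i)`. -/
def skewProd {r : ℕ} (z : Fin r → K) : K := ∏ i, ∏ j ∈ Finset.Ioi i, skewQuot (z i) (z j)

theorem skewProd_succ {r : ℕ} (z : Fin (r + 1) → K) :
    skewProd z = (∏ j : Fin r, skewQuot (z 0) (z j.succ)) * skewProd (fun i => z i.succ) := by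
  rw [skewProd, Fin.prod_univ_succ, Fin.prod_Ioi_zero, skewProd]
  simp only [Fin.prod_Ioi_succ]

/-- Moving `z_k` to the front passes it across `k` variables, each crossing changing the sign of one
factor. -/
theorem skewProd_eq_removeNth : ∀ {r : ℕ} (z : Fin (r + 1) → K) (k : Fin (r + 1)),
    skewProd z = (-1) ^ (k : ℕ) * (∏ i : Fin r, skewQuot (z k) (z (k.succAbove i))) *
      skewProd (fun i => z (k.succAbove i)) := by
  intro r
  induction r with
  | zero => intro z k; fin_cases k; simp [skewProd]
  | succ r ih =>
    intro z k
    refine Fin.cases ?_ (fun k => ?_) k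
    · rw [skewProd_succ]; simp
    · rw [skewProd_succ, ih _ k, skewProd_succ (fun i => z (k.succ.succAbove i)),
        Fin.prod_univ_succAbove _ k, Fin.prod_univ_succ (fun i => skewQuot (z k.succ) _)]
      simp only [Fin.succ_succAbove_zero, Fin.succ_succAbove_succ, Fin.val_succ]
      rw [skewQuot_swap (z 0) (z k.succ)]
      ring

/-- This vanishing is what allows sums over injections to be extended to all functions. -/
theorem skewProd_eq_zero {r : ℕ} (z : Fin r → K) (h : ¬ Function.Injective z) :
    skewProd z = 0 := by
  obtain ⟨i, j, hij, hne⟩ : ∃ i j, z i = z j ∧ i ≠ j := by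
    simpa [Function.Injective] using h
  wlog hlt : i < j generalizing i j
  · exact this j i hij.symm hne.symm (lt_of_le_of_ne (not_lt.1 hlt) hne.symm)
  exact Finset.prod_eq_zero (Finset.mem_univ i)
    (Finset.prod_eq_zero (Finset.mem_Ioi.2 hlt) (by rw [hij, skewQuot_self]))

/-- Schur's Pfaffian identity, as an expansion along the first row. -/
theorem sum_skewQuot_mul_skewProd {M : ℕ} (hM : Even M) (y : K) (z : Fin (M + 1) → K)
    (hz : ∀ i j, z i + z j ≠ 0) (hy : ∀ i, y + z i ≠ 0) :
    ∑ k : Fin (M + 1), (-1) ^ (k : ℕ) * skewQuot y (z k) * skewProd (fun i => z (k.succAbove i)) =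
      (∏ k, skewQuot y (z k)) * skewProd z := by
  by_cases hinj : Function.Injective z
  · have h2 : (2 : K) ≠ 0 := fun h => hz 0 0 (by rw [← two_mul, h, zero_mul])
    have hodd : (-1 : K) ^ (M + 1) = -1 := by rw [pow_succ, hM.neg_one_pow]; ring
    -- Deleting `z_k` divides `skewProd z` by factors that are, up to sign, the inverses of those in
    -- the weight of `k`. The `M` signs -1 cancel since `M` is even.
    have hk : ∀ k : Fin (M + 1), (-1) ^ (k : ℕ) * skewProd (fun i => z (k.succAbove i)) =
        pfWeight Finset.univ z k * skewProd z := by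
      intro k
      have e : pfWeight Finset.univ z k * ∏ i, skewQuot (z k) (z (k.succAbove i)) = 1 := by
        have e1 : pfWeight Finset.univ z k = ∏ i, (z k + z (k.succAbove i)) /
            (z k - z (k.succAbove i)) := by
          rw [pfWeight, ← Finset.compl_singleton, ← Fin.image_succAbove_univ,
            Finset.prod_image (fun a _ b _ h => Fin.succAbove_right_injective h)]
        rw [e1, ← Finset.prod_mul_distrib]
        have e2 : ∀ i, (z k + z (k.succAbove i)) / (z k - z (k.succAbove i)) *
            skewQuot (z k) (z (k.succAbove i)) = -1 := by
          intro i
          have h3 : z k - z (k.succAbove i) ≠ 0 := fun h =>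
            Fin.succAbove_ne k i (hinj (sub_eq_zero.1 h)).symm
          have h4 := hz (k.succAbove i) k
          rw [skewQuot]
          field_simp
          ring
        simp [e2, hM.neg_one_pow]
      rw [skewProd_eq_removeNth z k]
      have hs : ((-1 : K) ^ (k : ℕ)) * (-1) ^ (k : ℕ) = 1 := by rw [← mul_pow]; simp
      linear_combination (-(-1) ^ (k : ℕ) * skewProd (fun i => z (k.succAbove i))) * e
    have h3 : ∀ k : Fin (M + 1), (-1) ^ (k : ℕ) * skewQuot y (z k) * skewProd (fun i => z (k.succAbove i)) =
        pfWeight Finset.univ z k * skewQuot y (z k) * skewProd z := fun k => by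
      linear_combination skewQuot y (z k) * hk k
    simp only [h3]
    rw [← Finset.sum_mul]
    congr 1
    have h4 := prod_sub_div_add_eq Finset.univ z hinj.injOn y fun k _ => hy k
    have h5 := two_mul_sum_pfWeight Finset.univ z hinj.injOn
    rw [Finset.card_univ, Fintype.card_fin, hodd] at h4 h5
    have h6 : ∏ k, (y - z k) / (y + z k) = -∏ k, skewQuot y (z k) := by
      have : ∀ k, (y - z k) / (y + z k) = -1 * skewQuot y (z k) := fun k => by
        rw [skewQuot, add_comm]; ring
      simp only [this]
      rw [Finset.prod_mul_distrib, Finset.prod_const, Finset.card_univ, Fintype.card_fin, hodd]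
      ring
    -- Uses `(z_k - y)/(z_k + y) = 1 - 2y/(y + z_k)`, so that both partial fraction identities
    -- apply.
    have h7 : ∑ k, pfWeight Finset.univ z k * skewQuot y (z k) =
        ∑ k, pfWeight Finset.univ z k - ∑ k, 2 * pfWeight Finset.univ z k * (y / (y + z k)) := by
      rw [← Finset.sum_sub_distrib]
      refine Finset.sum_congr rfl fun k _ => ?_
      have := hy k
      rw [skewQuot, add_comm (z k)]
      field_simp
      ring
    rw [h7]
    have h8 : ∑ k, pfWeight Finset.univ z k = 1 := by
      apply mul_left_cancel₀ h2
      rw [h5]; ring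
    rw [h8]
    linear_combination h4 - h6
  -- If `z_a = z_b`, only the terms omitting `a` or `b` can survive; they involve the same variables
  -- and cancel by the sign of the reordering.
  · rw [skewProd_eq_zero z hinj, mul_zero]
    obtain ⟨a, b, hab, hne⟩ : ∃ i j, z i = z j ∧ i ≠ j := by
      simpa [Function.Injective] using hinj
    have hvan : ∀ k, k ≠ a → k ≠ b → skewProd (fun i => z (k.succAbove i)) = 0 := by
      intro k hka hkb
      obtain ⟨a', rfl⟩ := Fin.exists_succAbove_eq hka.symm
      obtain ⟨b', rfl⟩ := Fin.exists_succAbove_eq hkb.symm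
      exact skewProd_eq_zero _ fun h => hne (by rw [h hab])
    rw [Fintype.sum_eq_add a b hne fun k hk =>
      mul_eq_zero_of_right _ (hvan k hk.1 hk.2)]
    obtain ⟨j, rfl⟩ := Fin.exists_succAbove_eq hne.symm
    obtain _ | M := M
    · exact j.elim0
    rw [skewProd_eq_removeNth (fun i => z (a.succAbove i)) j,
      skewProd_eq_removeNth (fun i => z ((a.succAbove j).succAbove i)) (j.predAbove a)]
    simp only [Fin.succAbove_succAbove_succAbove_predAbove, Fin.succAbove_succAbove_predAbove, hab]
    have hs := Fin.neg_one_pow_succAbove_add_predAbove (R := K) a j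
    rw [pow_add, pow_add] at hs
    linear_combination (skewQuot y (z (a.succAbove j)) *
      (∏ i, skewQuot (z (a.succAbove j)) (z (a.succAbove (j.succAbove i)))) *
      skewProd fun i => z (a.succAbove (j.succAbove i))) * hs

end SkewProd

/-! ### Sums over functions and Pfaffians of bilinear forms -/

section SkewSum

theorem sum_fun_insertNth {M ι : Type*} [AddCommMonoid M] [Fintype ι] {r : ℕ} (k : Fin (r + 1))
    (G : (Fin (r + 1) → ι) → M) :
    ∑ σ, G σ = ∑ p, ∑ τ : Fin r → ι, G (k.insertNth (α := fun _ => ι) p τ) := by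
  rw [← Fintype.sum_prod_type' (f := fun p τ => G (k.insertNth (α := fun _ => ι) p τ))]
  exact (Equiv.sum_comp (Fin.insertNthEquiv (fun _ => ι) k) G).symm

theorem map_pfaffian {R S : Type*} [CommRing R] [CommRing S] (f : R →+* S) :
    ∀ (n : ℕ) (A : Matrix (Fin n) (Fin n) R), f (pfaffian n A) = pfaffian n (A.map f)
  | 0, _ => by simp [pfaffian]
  | 1, _ => by simp [pfaffian]
  | n + 2, A => by
    simp only [pfaffian, map_sum, map_mul, map_pow, map_neg, map_one, map_pfaffian f n,
      Matrix.submatrix_map, Matrix.map_apply]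

theorem map_pfaffianExt {R S : Type*} [CommRing R] [CommRing S] (f : R →+* S) (n : ℕ)
    (A : Matrix (Fin n) (Fin n) R) (m : Fin n → R) :
    f (pfaffianExt n A m) = pfaffianExt n (A.map f) (fun i => f (m i)) := by
  cases n with
  | zero => simp [pfaffianExt]
  | succ n =>
    rw [pfaffianExt, pfaffianExt]
    split_ifs
    · exact map_pfaffian f _ A
    · simp only [map_sum, map_mul, map_pow, map_neg, map_one, map_pfaffian f n,
        Matrix.submatrix_map]

variable {K ι : Type*} [Field K] [Fintype ι]

/-- `∑_{p, q} f_p h_q (x_q - x_p)/(x_q + x_p)`. -/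
def skewForm (x : ι → K) (f h : ι → K) : K :=
  ∑ p, ∑ q, f p * h q * skewQuot (x p) (x q)

/-- `∑_σ ∏_i φ_i(σ_i) ∏_{i < j} (x_{σ_j} - x_{σ_i})/(x_{σ_j} + x_{σ_i})`, over all functions `σ`. -/
def skewSum (x : ι → K) {r : ℕ} (φ : Fin r → ι → K) : K :=
  ∑ σ : Fin r → ι, (∏ i, φ i (σ i)) * skewProd (fun i => x (σ i))

/-- Schur's identity at `y = 0`, where every `skewQuot 0 z` equals 1, expands Schur's product over
the omitted index; the omitted variable is then summed freely. -/
theorem skewSum_odd (x : ι → K) (hx : ∀ p q, x p + x q ≠ 0) {r : ℕ} (hr : Even r)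
    (φ : Fin (r + 1) → ι → K) :
    skewSum x φ = ∑ k : Fin (r + 1), (-1) ^ (k : ℕ) * (∑ p, φ k p) *
      skewSum x (fun i => φ (k.succAbove i)) := by
  have hx0 : ∀ p, x p ≠ 0 := fun p h => hx p p (by rw [h, add_zero])
  have h1 : ∀ σ : Fin (r + 1) → ι, skewProd (fun i => x (σ i)) =
      ∑ k : Fin (r + 1), (-1) ^ (k : ℕ) * skewProd (fun i => x (σ (k.succAbove i))) := by
    intro σ
    have := sum_skewQuot_mul_skewProd hr 0 (fun i => x (σ i)) (fun i j => hx _ _)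
      (fun i => by rw [zero_add]; exact hx0 _)
    have h0 : ∀ i, skewQuot 0 (x (σ i)) = 1 := fun i => by
      rw [skewQuot, sub_zero, add_zero, div_self (hx0 _)]
    simpa [h0] using this.symm
  simp only [skewSum, h1, Finset.mul_sum]
  rw [Finset.sum_comm]
  refine Finset.sum_congr rfl fun k _ => ?_
  rw [sum_fun_insertNth k, Finset.sum_comm]
  refine Finset.sum_congr rfl fun τ _ => ?_
  rw [Finset.sum_mul]
  refine Finset.sum_congr rfl fun p _ => ?_
  rw [Fin.prod_univ_succAbove _ k]
  simp only [Fin.insertNth_apply_same, Fin.insertNth_apply_succAbove]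
  ring

/-- An analogue of de Bruijn's formula. In the first-row expansion, the values of σ at 0 and at
`k+1` are the two summation indices of the skew form, and Schur's identity reassembles the product
for each σ. -/
theorem pfaffian_skewForm (x : ι → K) (hx : ∀ p q, x p + x q ≠ 0) {r : ℕ} (hr : Even r)
    (φ : Fin r → ι → K) :
    pfaffian r (Matrix.of fun i j => skewForm x (φ i) (φ j)) = skewSum x φ := by
  have step : ∀ r : ℕ, Even r → (∀ φ : Fin r → ι → K,
      pfaffian r (Matrix.of fun i j => skewForm x (φ i) (φ j)) = skewSum x φ) →
      ∀ φ : Fin (r + 2) → ι → K,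
      pfaffian (r + 2) (Matrix.of fun i j => skewForm x (φ i) (φ j)) = skewSum x φ := by
    intro r hr ih φ
    rw [pfaffian]
    have h1 : ∀ σ : Fin (r + 2) → ι, skewProd (fun i => x (σ i)) =
        ∑ k : Fin (r + 1), (-1) ^ (k : ℕ) * skewQuot (x (σ 0)) (x (σ k.succ)) *
          skewProd (fun i => x (σ (k.succAbove i).succ)) := by
      intro σ
      rw [skewProd_succ]
      exact (sum_skewQuot_mul_skewProd hr (x (σ 0)) (fun i => x (σ i.succ))
        (fun i j => hx _ _) (fun i => hx _ _)).symm
    simp only [skewSum, h1, Finset.mul_sum]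
    rw [Finset.sum_comm]
    refine Finset.sum_congr rfl fun k _ => ?_
    have h2 := ih fun i => φ (k.succAbove i).succ
    simp only [Matrix.of_apply]
    have h3 : ((Matrix.of fun i j => skewForm x (φ i) (φ j)).submatrix
        (fun i => (k.succAbove i).succ) (fun i => (k.succAbove i).succ)) =
        Matrix.of fun i j => skewForm x (φ (k.succAbove i).succ) (φ (k.succAbove j).succ) := by
      ext i j; rfl
    rw [h3, h2, sum_fun_insertNth 0, skewForm, Finset.mul_sum, Finset.sum_mul]
    refine Finset.sum_congr rfl fun p _ => ?_
    rw [sum_fun_insertNth k, Finset.mul_sum, Finset.sum_mul]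
    refine Finset.sum_congr rfl fun q _ => ?_
    rw [skewSum, Finset.mul_sum]
    refine Finset.sum_congr rfl fun τ _ => ?_
    rw [Fin.prod_univ_succ, Fin.prod_univ_succAbove _ k]
    simp only [Fin.insertNth_zero', Fin.cons_succ, Fin.insertNth_apply_same,
      Fin.insertNth_apply_succAbove]
    ring
  obtain ⟨m, rfl⟩ := even_iff_exists_two_mul.1 hr
  clear hr
  induction m with
  | zero => simp [pfaffian, skewSum, skewProd]
  | succ m ih => exact step (2 * m) (even_two_mul m) ih φ

theorem pfaffianExt_skewForm (x : ι → K) (hx : ∀ p q, x p + x q ≠ 0) (r : ℕ)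
    (φ : Fin r → ι → K) :
    pfaffianExt r (Matrix.of fun i j => skewForm x (φ i) (φ j)) (fun i => ∑ p, φ i p) =
      skewSum x φ := by
  cases r with
  | zero => simp [pfaffianExt, skewSum, skewProd]
  | succ r =>
    rw [pfaffianExt]
    split_ifs with h
    · exact pfaffian_skewForm x hx h φ
    · have hr : Even r := by rwa [Nat.even_add_one, not_not] at h
      rw [skewSum_odd x hx hr]
      refine Finset.sum_congr rfl fun k _ => ?_
      rw [← pfaffian_skewForm x hx hr]
      rfl

theorem skewProd_snoc {r : ℕ} (z : Fin (r + 1) → K) :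
    skewProd z = (∏ i : Fin r, skewQuot (z i.castSucc) (z (Fin.last r))) *
      skewProd (fun i => z i.castSucc) := by
  rw [skewProd_eq_removeNth z (Fin.last r)]
  simp only [Fin.succAbove_last, Fin.val_last]
  congr 1
  rw [show ((-1 : K) ^ r) = ∏ _i : Fin r, (-1 : K) by simp, ← Finset.prod_mul_distrib]
  exact Finset.prod_congr rfl fun i _ => by rw [skewQuot_swap (z (Fin.last r))]; ring

variable [DecidableEq ι]

/-- Adding the function `1` to an odd number of functions, for an even number of variables. -/
theorem skewSum_snoc_pfWeight [CharZero K] (x : ι → K) (hinj : Function.Injective x)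
    (hx : ∀ p q, x p + x q ≠ 0) (hι : Even (Fintype.card ι)) {r : ℕ} (hr : Odd r)
    (φ : Fin (r + 1) → ι → K) (hφ : φ (Fin.last r) = pfWeight Finset.univ x) :
    skewSum x φ = skewSum x (fun i : Fin r => φ i.castSucc) := by
  rw [skewSum, sum_fun_insertNth (Fin.last r), Finset.sum_comm, skewSum]
  refine Finset.sum_congr rfl fun τ _ => ?_
  simp only [Fin.prod_univ_castSucc, skewProd_snoc, Fin.insertNth_last', Fin.snoc_castSucc,
    Fin.snoc_last, hφ]
  by_cases hτ : Function.Injective τ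
  -- The terms with `q` in the image `T` of τ vanish. For the others the quotients cancel the
  -- factors of the weight coming from `T`, leaving the weight relative to the complement of `T`,
  -- which has odd size because `n` is even and `r` odd.
  · have key : ∑ q, pfWeight Finset.univ x q * ∏ i, skewQuot (x (τ i)) (x q) = 1 := by
      set T : Finset ι := Finset.univ.image τ with hT
      have hcard : T.card = r := by
        rw [hT, Finset.card_image_of_injective _ hτ, Finset.card_univ, Fintype.card_fin]
      have h1 : ∀ q, ∏ i, skewQuot (x (τ i)) (x q) = ∏ m ∈ T, skewQuot (x m) (x q) :=
        fun q => by
          rw [hT, Finset.prod_image fun a _ b _ h => hτ h]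
      simp only [h1]
      rw [← Finset.sum_compl_add_sum T, Finset.sum_eq_zero (s := T) fun q hq =>
        mul_eq_zero_of_right _ (Finset.prod_eq_zero hq (skewQuot_self _)), add_zero]
      have h2 : ∀ q ∈ Tᶜ, pfWeight Finset.univ x q * ∏ m ∈ T, skewQuot (x m) (x q) =
          pfWeight Tᶜ x q := by
        intro q hq
        have hqT : q ∉ T := Finset.mem_compl.1 hq
        have e : Finset.univ.erase q = Tᶜ.erase q ∪ T := by
          ext m
          simp only [Finset.mem_erase, Finset.mem_univ, Finset.mem_union, Finset.mem_compl]
          refine ⟨fun h => ?_, fun h => ⟨?_, trivial⟩⟩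
          · by_cases hm : m ∈ T <;> simp [hm, h.1]
          · rintro rfl
            simp [hqT] at h
        rw [pfWeight, e, Finset.prod_union, mul_assoc, ← Finset.prod_mul_distrib,
          Finset.prod_eq_one (s := T), mul_one, pfWeight]
        · intro m hm
          have hne : x q - x m ≠ 0 := fun h => hqT (hinj (sub_eq_zero.1 h) ▸ hm)
          have := hx q m
          rw [skewQuot]
          field_simp
        · exact Finset.disjoint_left.2 fun m hm hm' =>
            Finset.mem_compl.1 (Finset.mem_of_mem_erase hm) hm'
      rw [Finset.sum_congr rfl h2]
      have h3 := two_mul_sum_pfWeight Tᶜ x hinj.injOn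
      have hle : r ≤ Fintype.card ι := hcard ▸ Finset.card_le_univ T
      rw [Finset.card_compl, hcard, Odd.neg_one_pow (Nat.Even.sub_odd hle hι hr)] at h3
      have h2' : (2 : K) ≠ 0 := two_ne_zero
      apply mul_left_cancel₀ h2'
      rw [h3]; ring
    calc _ = (∑ q, pfWeight Finset.univ x q * ∏ i, skewQuot (x (τ i)) (x q)) *
          ((∏ i, φ i.castSucc (τ i)) * skewProd fun i => x (τ i)) := by
          rw [Finset.sum_mul]
          exact Finset.sum_congr rfl fun q _ => by ring
      _ = _ := by rw [key, one_mul]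
  · rw [skewProd_eq_zero (fun i => x (τ i)) fun h => hτ fun a b hab => h (congrArg x hab)]
    simp

end SkewSum

/-! ### Symmetrization -/

section Symmetrization

/-- If `g` is one extension of σ, the others are `g` times the permutations fixing the first `r`
positions. -/
theorem card_perm_extending {n r : ℕ} (h : r ≤ n) (σ : Fin r → Fin n)
    (hσ : Function.Injective σ) :
    (Finset.univ.filter fun w : Equiv.Perm (Fin n) => (fun i => w (Fin.castLE h i)) = σ).card =
      (n - r).factorial := by
  obtain ⟨g, hg⟩ := (Equiv.Perm.isMultiplyPretransitive (Fin n) r).exists_smul_eq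
    (⟨Fin.castLE h, Fin.castLE_injective h⟩ : Fin r ↪ Fin n) ⟨σ, hσ⟩
  have hg' : ∀ i, g (Fin.castLE h i) = σ i := fun i => DFunLike.congr_fun hg i
  let e : Equiv.Perm {j : Fin n // r ≤ (j : ℕ)} ≃
      {w : Equiv.Perm (Fin n) // (fun i => w (Fin.castLE h i)) = σ} :=
    (Equiv.Perm.subtypeEquivSubtypePerm _).trans
      ((Equiv.mulLeft g).subtypeEquiv fun w => by
        constructor
        · intro hw
          funext i
          simp [hw (Fin.castLE h i) (by simp), hg']
        · intro hw a ha
          have := congrFun hw ⟨a, not_le.1 ha⟩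
          simp only [Equiv.coe_mulLeft, Equiv.Perm.mul_apply] at this
          rw [← hg'] at this
          exact g.injective this)
  rw [← Fintype.card_subtype, ← Fintype.card_congr e, Fintype.card_perm]
  congr 1
  rw [Fintype.card_subtype]
  have := Finset.card_filter_add_card_filter_not (s := (Finset.univ : Finset (Fin n)))
    (fun j : Fin n => (j : ℕ) < r)
  rw [Fin.card_filter_val_lt, Finset.card_univ, Fintype.card_fin, min_eq_right h] at this
  simp only [not_lt] at this
  omega

theorem sum_perm_restrict {M : Type*} [CommRing M] {n r : ℕ} (h : r ≤ n)
    (H : (Fin r → Fin n) → M) (hH : ∀ σ, ¬ Function.Injective σ → H σ = 0) :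
    ∑ w : Equiv.Perm (Fin n), H (fun i => w (Fin.castLE h i)) =
      (n - r).factorial * ∑ σ, H σ := by
  rw [← Finset.sum_fiberwise_of_maps_to (s := Finset.univ) (t := Finset.univ)
    (g := fun (w : Equiv.Perm (Fin n)) i => w (Fin.castLE h i)) (fun _ _ => Finset.mem_univ _),
    Finset.mul_sum]
  refine Finset.sum_congr rfl fun σ _ => ?_
  rw [Finset.sum_congr rfl (g := fun _ => H σ) fun w hw => by rw [(Finset.mem_filter.1 hw).2],
    Finset.sum_const, nsmul_eq_mul]
  by_cases hσ : Function.Injective σ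
  · rw [card_perm_extending h σ hσ]
  · rw [hH σ hσ, mul_zero, mul_zero]

theorem prod_filter_lt {M : Type*} [CommMonoid M] {n r : ℕ} (h : r ≤ n) (f : Fin n → M) :
    ∏ i ∈ Finset.univ.filter (fun i : Fin n => (i : ℕ) < r), f i =
      ∏ i : Fin r, f (Fin.castLE h i) := by
  symm
  refine Finset.prod_bij (fun i _ => Fin.castLE h i) (fun i _ => by simp)
    (fun a _ b _ hab => Fin.castLE_injective h hab) (fun j hj => ?_) fun _ _ => rfl
  exact ⟨⟨j, (Finset.mem_filter.1 hj).2⟩, Finset.mem_univ _, rfl⟩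

theorem prod_Iio_castLE {M : Type*} [CommMonoid M] {n r : ℕ} (h : r ≤ n) (f : Fin n → M)
    (i : Fin r) : ∏ j ∈ Finset.Iio (Fin.castLE h i), f j = ∏ j ∈ Finset.Iio i, f (j.castLE h) := by
  simp [← Fin.map_castLEEmb_Iio]

/-- Ivanov's factorial `P`-function as a sum over all functions. -/
theorem factorialP_eq_skewSum {K : Type*} [Field K] [CharZero K] (n : ℕ) (x : Fin n → K)
    (hinj : Function.Injective x) (hx : ∀ p q, x p + x q ≠ 0) (a : ℕ → K) (lam : List ℕ)
    (h : lam.length ≤ n) :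
    factorialP n x a lam = skewSum x (fun (i : Fin lam.length) p =>
      (∏ m ∈ Finset.range (lam.getD i 0), (x p - a m)) * pfWeight Finset.univ x p) := by
  have hfac : (((n - lam.length).factorial : ℕ) : K) ≠ 0 :=
    Nat.cast_ne_zero.2 (Nat.factorial_ne_zero _)
  rw [factorialP, inv_mul_eq_iff_eq_mul₀ hfac, skewSum, ← sum_perm_restrict h]
  · refine Finset.sum_congr rfl fun w _ => ?_
    rw [prod_filter_lt h, Finset.prod_mul_distrib, Finset.prod_mul_distrib, mul_assoc]
    congr 1
    set u : Fin n → Fin n → K := fun i j => (x (w i) + x (w j)) / (x (w i) - x (w j)) with hu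
    have h1 : ∀ i, pfWeight Finset.univ x (w i) =
        (∏ j ∈ Finset.Iio i, u i j) * ∏ j ∈ Finset.Ioi i, u i j := by
      intro i
      rw [← Finset.prod_union (Finset.disjoint_left.2 fun j hj hj' =>
        lt_asymm (Finset.mem_Iio.1 hj) (Finset.mem_Ioi.1 hj')), pfWeight]
      symm
      refine Finset.prod_bij (fun j _ => w j) (fun j hj => ?_) (fun _ _ _ _ hab => w.injective hab)
        (fun j hj => ?_) fun _ _ => rfl
      · have : j ≠ i := by
          simp only [Finset.mem_union, Finset.mem_Iio, Finset.mem_Ioi] at hj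
          exact hj.elim ne_of_lt ne_of_gt
        simpa using this
      · refine ⟨w.symm j, ?_, by simp⟩
        have : w.symm j ≠ i := by
          rintro rfl
          simp at hj
        simpa using lt_or_gt_of_ne this
    -- Ivanov's product has only the factors with `j > i`; the factors `j < i` of the full weights
    -- are the inverses of those of Schur's product.
    have h2 : (∏ i : Fin lam.length, ∏ j ∈ Finset.Iio (Fin.castLE h i), u (Fin.castLE h i) j) *
        skewProd (fun i => x (w (Fin.castLE h i))) = 1 := by
      simp only [prod_Iio_castLE]
      have e : skewProd (fun i => x (w (Fin.castLE h i))) =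
          ∏ j : Fin lam.length, ∏ i ∈ Finset.Iio j,
            skewQuot (x (w (Fin.castLE h i))) (x (w (Fin.castLE h j))) :=
        Finset.prod_comm' (by simp)
      rw [e, ← Finset.prod_mul_distrib]
      refine Finset.prod_eq_one fun i _ => ?_
      rw [← Finset.prod_mul_distrib]
      refine Finset.prod_eq_one fun j hj => ?_
      have h3 := hx (w (Fin.castLE h i)) (w (Fin.castLE h j))
      have h4 : x (w (Fin.castLE h i)) - x (w (Fin.castLE h j)) ≠ 0 := fun h0 => by
        have := Fin.castLE_injective h (w.injective (hinj (sub_eq_zero.1 h0)))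
        exact (Finset.mem_Iio.1 hj).ne this.symm
      rw [hu, skewQuot]
      field_simp
    simp only [h1, Finset.prod_mul_distrib]
    linear_combination
      -(∏ i : Fin lam.length, ∏ j ∈ Finset.Ioi (Fin.castLE h i), u (Fin.castLE h i) j) * h2
  · intro σ hσ
    rw [skewProd_eq_zero (fun i => x (σ i)) fun h => hσ fun a b hab => h (congrArg x hab), mul_zero]

end Symmetrization

/-! ### Generating series -/

section Series

variable {K : Type*} [Field K]

/-- `1/(1 - y u)`. -/
noncomputable def geomSeries (y : K) : PowerSeries K := PowerSeries.mk fun j => y ^ j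

theorem one_sub_mul_geomSeries (y : K) :
    (1 - PowerSeries.C y * PowerSeries.X) * geomSeries y = 1 := by
  ext m
  rw [sub_mul, one_mul, map_sub, mul_assoc, PowerSeries.coeff_C_mul, PowerSeries.coeff_one]
  cases m with
  | zero => simp [geomSeries]
  | succ m =>
    rw [mul_comm PowerSeries.X, PowerSeries.coeff_succ_mul_X]
    simp [geomSeries, pow_succ, mul_comm]

theorem one_sub_C_mul_X_ne_zero (y : K) :
    (1 - PowerSeries.C y * PowerSeries.X : PowerSeries K) ≠ 0 := fun h => by
  have := one_sub_mul_geomSeries y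
  rw [h, zero_mul] at this
  exact zero_ne_one this

/-- `∏_{j=1}^{k} (1 + t_j u)`. -/
noncomputable def elemSeriesAt (t : ℕ → K) (k : ℕ) : PowerSeries K :=
  ∏ j ∈ Finset.range k, (1 + PowerSeries.C (t j) * PowerSeries.X)

theorem elemSeriesAt_succ (t : ℕ → K) (k : ℕ) : elemSeriesAt t (k + 1) =
    elemSeriesAt t k + PowerSeries.C (t k) * (elemSeriesAt t k * PowerSeries.X) := by
  rw [elemSeriesAt, Finset.prod_range_succ, ← elemSeriesAt]
  ring

theorem coeff_elemSeriesAt_eq_zero (t : ℕ → K) (k m : ℕ) (h : k < m) :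
    PowerSeries.coeff m (elemSeriesAt t k) = 0 := by
  induction k generalizing m with
  | zero => simp [elemSeriesAt, PowerSeries.coeff_one, show m ≠ 0 by omega]
  | succ k ih =>
    obtain ⟨m, rfl⟩ : ∃ i, m = i + 1 := ⟨m - 1, by omega⟩
    rw [elemSeriesAt_succ, map_add, PowerSeries.coeff_C_mul, PowerSeries.coeff_succ_mul_X,
      ih _ (by omega), ih _ (by omega)]
    simp

/-- Since `∏ (1 + t_j u)` has degree at most `k`, for `m ≥ k` no term is truncated and the
coefficient is formally `y^m ∏ (1 + t_j/y)`. -/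
theorem coeff_elemSeriesAt_mul_geomSeries (t : ℕ → K) (y : K) (k m : ℕ) (h : k ≤ m) :
    PowerSeries.coeff m (elemSeriesAt t k * geomSeries y) =
      y ^ (m - k) * ∏ j ∈ Finset.range k, (y + t j) := by
  induction k generalizing m with
  | zero => simp [elemSeriesAt, geomSeries]
  | succ k ih =>
    obtain ⟨m, rfl⟩ : ∃ i, m = i + 1 := ⟨m - 1, by omega⟩
    have e : elemSeriesAt t (k + 1) * geomSeries y = elemSeriesAt t k * geomSeries y +
        PowerSeries.C (t k) * (elemSeriesAt t k * geomSeries y * PowerSeries.X) := by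
      rw [elemSeriesAt_succ]; ring
    rw [e, map_add, PowerSeries.coeff_C_mul, PowerSeries.coeff_succ_mul_X,
      ih _ (by omega), ih _ (by omega), Finset.prod_range_succ, Nat.add_sub_add_right,
      show m + 1 - k = m - k + 1 by omega]
    ring

/-- `(1 - y u)/(1 + y u)`. -/
noncomputable def reflSeries (y : K) : PowerSeries K := 2 * geomSeries (-y) - 1

theorem coeff_mul_reflSeries (A : PowerSeries K) (y : K) (l : ℕ) :
    PowerSeries.coeff l (A * reflSeries y) = PowerSeries.coeff l A +
      2 * ∑ j ∈ Finset.Icc 1 l, (-y) ^ j * PowerSeries.coeff (l - j) A := by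
  have h : A * reflSeries y = PowerSeries.C 2 * (geomSeries (-y) * A) - A := by
    rw [reflSeries, map_ofNat]; ring
  rw [h, map_sub, PowerSeries.coeff_C_mul, PowerSeries.coeff_mul,
    Finset.Nat.sum_antidiagonal_eq_sum_range_succ_mk, Finset.sum_range_succ',
    ← Finset.Ico_add_one_right_eq_Icc, Finset.sum_Ico_eq_sum_range]
  simp only [geomSeries, PowerSeries.coeff_mk, add_tsub_cancel_right, pow_zero, one_mul,
    Nat.sub_zero, add_comm 1]
  ring

variable {n : ℕ}

theorem schurSeries_eq (x : Fin n → K) (hinj : Function.Injective x) :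
    schurSeries x = PowerSeries.C ((-1) ^ n) +
      ∑ p, PowerSeries.C (2 * pfWeight Finset.univ x p) * geomSeries (x p) := by
  ext j
  rw [schurSeries, coeff_prod_schur _ _ hinj.injOn, map_add, map_sum, PowerSeries.coeff_C,
    Finset.card_univ, Fintype.card_fin, add_comm]
  simp only [geomSeries, PowerSeries.coeff_C_mul, PowerSeries.coeff_mk]

/-- Partial fractions in `u`: `skewQuot y z` is the value of `(1 - yu)/(1 + yu)` at `u = 1/z`. -/
theorem reflSeries_mul_geomSeries (y z : K) (h : z + y ≠ 0) :
    reflSeries y * geomSeries z = PowerSeries.C (skewQuot y z) * geomSeries z +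
      PowerSeries.C (1 - skewQuot y z) * geomSeries (-y) := by
  have h1 := one_sub_mul_geomSeries z
  have h2 := one_sub_mul_geomSeries (-y)
  apply mul_left_cancel₀ (one_sub_C_mul_X_ne_zero z)
  apply mul_left_cancel₀ (one_sub_C_mul_X_ne_zero (-y))
  have h3 : skewQuot y z * (z + y) = z - y := by rw [skewQuot, div_mul_cancel₀ _ h]
  have h4 := congrArg (PowerSeries.C (R := K)) h3
  simp only [map_mul, map_add, map_sub, map_neg, map_one] at *
  rw [reflSeries]
  linear_combination (2 * (1 - PowerSeries.C z * PowerSeries.X) * geomSeries z -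
      (1 - PowerSeries.C (skewQuot y z)) *
      (1 - PowerSeries.C z * PowerSeries.X)) * h2 +
    (2 - (1 + PowerSeries.C y * PowerSeries.X) -
      PowerSeries.C (skewQuot y z) * (1 + PowerSeries.C y * PowerSeries.X)) * h1 -
    PowerSeries.X * h4

/-- The numerator factor `1 + x_p u` of the Schur series cancels the new denominator, so no pole at
`u = -1/x_p` appears. The constant changes sign. -/
theorem schurSeries_mul_reflSeries (x : Fin n → K) (hinj : Function.Injective x)
    (hx : ∀ p q, x p + x q ≠ 0) (p : Fin n) :
    schurSeries x * reflSeries (x p) =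
      (∑ q, PowerSeries.C (2 * pfWeight Finset.univ x q * skewQuot (x p) (x q)) *
        geomSeries (x q)) - PowerSeries.C ((-1) ^ n) := by
  have h1 := prod_sub_div_add_eq Finset.univ x hinj.injOn (x p) fun k _ => hx p k
  -- At `y = x_p` the product contains the factor `y - x_p = 0`.
  rw [Finset.prod_eq_zero (Finset.mem_univ p) (by simp), Finset.card_univ, Fintype.card_fin] at h1
  have h2 : ∑ q, 2 * pfWeight Finset.univ x q * (1 - skewQuot (x p) (x q)) = -2 * (-1) ^ n := by
    have : ∀ q, 2 * pfWeight Finset.univ x q * (1 - skewQuot (x p) (x q)) =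
        2 * (2 * pfWeight Finset.univ x q * (x p / (x p + x q))) := fun q => by
      have := hx p q
      rw [skewQuot, add_comm (x q)]
      field_simp
      ring
    simp only [this]
    rw [← Finset.mul_sum]
    linear_combination -2 * h1
  have h3 : ∀ q, PowerSeries.C (2 * pfWeight Finset.univ x q) * geomSeries (x q) *
      reflSeries (x p) =
      PowerSeries.C (2 * pfWeight Finset.univ x q * skewQuot (x p) (x q)) * geomSeries (x q) +
      PowerSeries.C (2 * pfWeight Finset.univ x q * (1 - skewQuot (x p) (x q))) *
        geomSeries (-x p) := fun q => by
    rw [mul_assoc, mul_comm (geomSeries _), reflSeries_mul_geomSeries _ _ (hx q p), map_mul _ _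
      (skewQuot _ _), map_mul _ _ (1 - skewQuot _ _)]
    ring
  rw [schurSeries_eq x hinj, add_mul, Finset.sum_mul, Finset.sum_congr rfl fun q _ => h3 q,
    Finset.sum_add_distrib, ← Finset.sum_mul, ← map_sum, h2, map_mul, reflSeries, map_neg,
    map_ofNat]
  ring

/-- `∑_p 2 g_p x_p^{m-k} ∏_{j ≤ k} (x_p + t_j)`, up to the contribution of the constant term. -/
theorem coeff_schurSeries_mul_elem (x : Fin n → K) (hinj : Function.Injective x) (t : ℕ → K)
    (k m : ℕ) (h : k ≤ m) :
    PowerSeries.coeff m (schurSeries x * elemSeriesAt t k) =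
      ∑ p, 2 * pfWeight Finset.univ x p * (x p ^ (m - k) * ∏ j ∈ Finset.range k, (x p + t j)) +
        (-1) ^ n * PowerSeries.coeff m (elemSeriesAt t k) := by
  rw [schurSeries_eq x hinj, add_mul, Finset.sum_mul, map_add, map_sum, PowerSeries.coeff_C_mul,
    add_comm]
  congr 1
  refine Finset.sum_congr rfl fun p _ => ?_
  rw [mul_assoc, PowerSeries.coeff_C_mul, mul_comm (geomSeries _),
    coeff_elemSeriesAt_mul_geomSeries _ _ _ _ h]

theorem coeff_schurSeries_mul_elem_mul_refl (x : Fin n → K) (hinj : Function.Injective x)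
    (hx : ∀ p q, x p + x q ≠ 0) (t : ℕ → K) (k m : ℕ) (h : k ≤ m) (p : Fin n) :
    PowerSeries.coeff m (schurSeries x * elemSeriesAt t k * reflSeries (x p)) =
      ∑ q, 2 * pfWeight Finset.univ x q * skewQuot (x p) (x q) *
        (x q ^ (m - k) * ∏ j ∈ Finset.range k, (x q + t j)) -
        (-1) ^ n * PowerSeries.coeff m (elemSeriesAt t k) := by
  rw [mul_right_comm, schurSeries_mul_reflSeries x hinj hx, sub_mul, Finset.sum_mul, map_sub,
    map_sum, PowerSeries.coeff_C_mul]
  congr 1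
  refine Finset.sum_congr rfl fun q _ => ?_
  rw [mul_assoc, PowerSeries.coeff_C_mul, mul_comm (geomSeries _),
    coeff_elemSeriesAt_mul_geomSeries _ _ _ _ h]

end Series

/-! ### Two-index polynomials as bilinear forms -/

section Realization

theorem map_elemSeries {R K : Type*} [CommRing R] [Field K] (f : R →+* K) (t : ℕ → K) (k : ℕ) :
    PowerSeries.map (MvPolynomial.eval₂Hom f t) (elemSeries R k) = elemSeriesAt t k := by
  simp [elemSeries, elemSeriesAt]

variable {n : ℕ}

theorem xv_injective (n : ℕ) : Function.Injective (xv n) := fun _ _ h =>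
  MvPolynomial.X_injective (IsFractionRing.injective _ (RatXT n) h)

theorem xv_add_xv_ne_zero (n : ℕ) (p q : Fin n) : xv n p + xv n q ≠ 0 := by
  rw [xv, xv, ← map_add]
  intro h
  have h1 := IsFractionRing.injective _ (RatXT n) (h.trans (map_zero _).symm)
  have h2 := congrArg (MvPolynomial.eval fun _ => 1) h1
  simp only [map_add, MvPolynomial.eval_X, map_zero] at h2
  norm_num at h2

theorem realizeC_q (k m : ℕ) : realizeC n (q k m) =
    PowerSeries.coeff m (schurSeries (xv n) * elemSeriesAt (tv n) (k - 1)) := by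
  rw [q, ← PowerSeries.coeff_map, qSeries, map_mul, realizeC, map_elemSeries]
  congr 2
  ext p
  rw [PowerSeries.coeff_map, PowerSeries.coeff_mk, MvPolynomial.coe_eval₂Hom,
    MvPolynomial.eval₂_C, Qgen]
  exact eval_gen _ (schurQ_zero _) p

theorem realizeD_eD (k m : ℕ) : realizeD n (eD k m) =
    PowerSeries.coeff m (elemSeriesAt (tv n) k) := by
  rw [eD, ← PowerSeries.coeff_map, realizeD, map_elemSeries]

theorem realizeD_rD (k m : ℕ) : realizeD n (rD k m) =
    PowerSeries.coeff m (schurSeries (xv n) * elemSeriesAt (tv n) k) := by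
  rw [rD, ← PowerSeries.coeff_map, rSeries, map_mul, realizeD, map_elemSeries]
  congr 2
  ext p
  rw [PowerSeries.coeff_map, PowerSeries.coeff_mk, MvPolynomial.coe_eval₂Hom,
    MvPolynomial.eval₂_C]
  split_ifs with h
  · rw [map_one, h]
    exact (schurQ_zero _).symm
  · have e : symD (xv n) (Pgen p) = schurP (xv n) p := eval_gen _ (by simp [schurP]) p
    rw [map_mul, map_ofNat, e, schurP, if_neg h, mul_div_cancel₀ _ two_ne_zero, schurQ]

/-- The function `2 y (y + t_1) ⋯ (y + t_{k-1}) g` on the variables. -/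
noncomputable def evalC (n k : ℕ) (p : Fin n) : RatXT n :=
  2 * ((∏ m ∈ Finset.range k, (xv n p - shiftZero (fun j => -tv n j) m)) *
    pfWeight Finset.univ (xv n) p)

/-- The function `(y + t_1) ⋯ (y + t_k) g` on the variables. -/
noncomputable def evalD (n k : ℕ) (p : Fin n) : RatXT n :=
  (∏ m ∈ Finset.range k, (xv n p - -tv n m)) * pfWeight Finset.univ (xv n) p

theorem evalC_eq (k : ℕ) (hk : 0 < k) (p : Fin n) : evalC n k p =
    2 * pfWeight Finset.univ (xv n) p *
      (xv n p * ∏ j ∈ Finset.range (k - 1), (xv n p + tv n j)) := by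
  obtain ⟨k, rfl⟩ : ∃ i, k = i + 1 := ⟨k - 1, by omega⟩
  rw [evalC, Finset.prod_range_succ', Nat.add_sub_cancel]
  simp only [shiftZero, sub_neg_eq_add, sub_zero]
  ring

theorem evalD_eq (k : ℕ) (p : Fin n) : evalD n k p =
    pfWeight Finset.univ (xv n) p * ∏ j ∈ Finset.range k, (xv n p + tv n j) := by
  rw [evalD, mul_comm]
  simp only [sub_neg_eq_add]

/-- Only `k - 1` factors `1 + t_j u` occur, so the constant `(-1)^n` contributes nothing in degree
at least `k`, whatever the parity of `n`. The degree excess `j + 1` supplies the factor `x_p` of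
`evalC`. -/
theorem realizeC_q_add (k j : ℕ) (hk : 0 < k) :
    realizeC n (q k (k + j)) = ∑ p, evalC n k p * xv n p ^ j := by
  rw [realizeC_q, coeff_schurSeries_mul_elem _ (xv_injective n) _ _ _ (by omega),
    coeff_elemSeriesAt_eq_zero _ _ _ (by omega), mul_zero, add_zero]
  refine Finset.sum_congr rfl fun p _ => ?_
  rw [evalC_eq k hk, show k + j - (k - 1) = j + 1 by omega]
  ring

theorem realizeC_QQ2 (k l : ℕ) (hk : 0 < k) (hl : 0 < l) :
    realizeC n (QQ2 k l) = skewForm (xv n) (evalC n k) (evalC n l) := by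
  have h : ∀ p, realizeC n (q l l) + 2 * ∑ j ∈ Finset.Icc 1 l, (-xv n p) ^ j *
      realizeC n (q l (l - j)) = ∑ q, evalC n l q * skewQuot (xv n p) (xv n q) := by
    intro p
    simp only [realizeC_q]
    rw [← coeff_mul_reflSeries, coeff_schurSeries_mul_elem_mul_refl _ (xv_injective n)
      (xv_add_xv_ne_zero n) _ _ _ (by omega), coeff_elemSeriesAt_eq_zero _ _ _ (by omega), mul_zero,
      sub_zero]
    refine Finset.sum_congr rfl fun q _ => ?_
    rw [evalC_eq l hl, show l - (l - 1) = 1 by omega]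
    ring
  have h0 : realizeC n (q k k) = ∑ p, evalC n k p := by
    simpa using realizeC_q_add (n := n) k 0 hk
  have h1 : skewForm (xv n) (evalC n k) (evalC n l) = ∑ p, evalC n k p *
      (realizeC n (q l l) + 2 * ∑ j ∈ Finset.Icc 1 l, (-xv n p) ^ j *
      realizeC n (q l (l - j))) := by
    refine Finset.sum_congr rfl fun p _ => ?_
    rw [h, Finset.mul_sum]
    exact Finset.sum_congr rfl fun q _ => by ring
  rw [h1, QQ2]
  simp only [map_add, map_mul, map_sum, map_pow, map_neg, map_one, map_ofNat, mul_add,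
    Finset.sum_add_distrib, ← Finset.sum_mul, h0, realizeC_q_add k _ hk, Finset.mul_sum]
  rw [Finset.sum_comm (s := Finset.univ)]
  congr 1
  refine Finset.sum_congr rfl fun j _ => ?_
  rw [Finset.sum_mul, Finset.mul_sum]
  refine Finset.sum_congr rfl fun p _ => ?_
  rw [neg_pow (xv n p)]
  ring

theorem realizeD_rD_add (hn : Even n) (k j : ℕ) : realizeD n (rD k (k + j)) =
    ∑ p, 2 * evalD n k p * xv n p ^ j + realizeD n (eD k (k + j)) := by
  rw [realizeD_rD, coeff_schurSeries_mul_elem _ (xv_injective n) _ _ _ (by omega),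
    hn.neg_one_pow, one_mul, realizeD_eD]
  congr 1
  refine Finset.sum_congr rfl fun p _ => ?_
  rw [evalD_eq, Nat.add_sub_cancel_left]
  ring

/-- With `k` factors `1 + t_j u` the constant does contribute, namely `e(k)_k` to `r(k)_k` and,
after reflection, `-e(l)_l`. The factors `r(k)_k - e(k)_k` and `r(l)_l + e(l)_l` remove exactly
these terms when `n` is even. -/
theorem realizeD_RR2 (hn : Even n) (k l : ℕ) :
    realizeD n (RR2 k l) = skewForm (xv n) (evalD n k) (evalD n l) := by
  have h : ∀ p, realizeD n (rD l l) + realizeD n (eD l l) + 2 * ∑ j ∈ Finset.Icc 1 l,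
      (-xv n p) ^ j * realizeD n (rD l (l - j)) =
      ∑ q, 2 * evalD n l q * skewQuot (xv n p) (xv n q) := by
    intro p
    simp only [realizeD_rD, realizeD_eD]
    rw [add_right_comm, ← coeff_mul_reflSeries, coeff_schurSeries_mul_elem_mul_refl _
      (xv_injective n) (xv_add_xv_ne_zero n) _ _ _ le_rfl, hn.neg_one_pow, one_mul,
      sub_add_cancel]
    refine Finset.sum_congr rfl fun q _ => ?_
    rw [evalD_eq, Nat.sub_self]
    ring
  have h0 : realizeD n (rD k k) - realizeD n (eD k k) = ∑ p, 2 * evalD n k p := by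
    simpa [sub_eq_iff_eq_add] using realizeD_rD_add hn k 0
  have h2 : ∀ j ∈ Finset.Icc 1 l, realizeD n (rD k (k + j)) =
      ∑ p, 2 * evalD n k p * xv n p ^ j := fun j hj => by
    rw [realizeD_rD_add hn, realizeD_eD, coeff_elemSeriesAt_eq_zero, add_zero]
    have := (Finset.mem_Icc.1 hj).1
    omega
  have h1 : 4 * skewForm (xv n) (evalD n k) (evalD n l) = ∑ p, 2 * evalD n k p *
      (realizeD n (rD l l) + realizeD n (eD l l) + 2 * ∑ j ∈ Finset.Icc 1 l, (-xv n p) ^ j *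
      realizeD n (rD l (l - j))) := by
    rw [skewForm, Finset.mul_sum]
    refine Finset.sum_congr rfl fun p _ => ?_
    rw [h, Finset.mul_sum, Finset.mul_sum]
    exact Finset.sum_congr rfl fun q _ => by ring
  apply mul_left_cancel₀ (show (4 : RatXT n) ≠ 0 by norm_num)
  rw [h1, ← map_ofNat (realizeD n) 4, ← map_mul, four_mul_RR2]
  simp only [map_add, map_mul, map_sub, map_sum, map_pow, map_neg, map_one, map_ofNat]
  rw [h0, Finset.sum_mul]
  have h3 : ∀ p, 2 * evalD n k p *
      (realizeD n (rD l l) + realizeD n (eD l l) + 2 * ∑ j ∈ Finset.Icc 1 l, (-xv n p) ^ j *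
      realizeD n (rD l (l - j))) =
      2 * evalD n k p * (realizeD n (rD l l) + realizeD n (eD l l)) +
      ∑ j ∈ Finset.Icc 1 l, 2 * ((-1) ^ j * (2 * evalD n k p * xv n p ^ j) *
        realizeD n (rD l (l - j))) := fun p => by
    rw [mul_add, Finset.mul_sum, Finset.mul_sum]
    congr 1
    refine Finset.sum_congr rfl fun j _ => ?_
    rw [neg_pow (xv n p)]
    ring
  simp only [h3]
  rw [Finset.sum_add_distrib, Finset.sum_comm (s := Finset.univ), Finset.mul_sum]
  congr 1
  refine Finset.sum_congr rfl fun j hj => ?_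
  rw [h2 j hj, ← Finset.mul_sum, ← Finset.sum_mul, ← Finset.mul_sum]

end Realization

/-! ### The main theorem -/

theorem realizeC_QQ (n : ℕ) (lam : List ℕ) (hpos : ∀ a ∈ lam, 0 < a) (h : lam.length ≤ n) :
    realizeC n (QQ lam) = factorialQ n (xv n) (fun j => -tv n j) lam := by
  have hget : ∀ i : Fin lam.length, lam.getD i 0 = lam.get i := fun i => by simp
  have hp : ∀ i : Fin lam.length, 0 < lam.get i := fun i => hpos _ (lam.get_mem i)
  rw [factorialQ, factorialP_eq_skewSum n _ (xv_injective n) (xv_add_xv_ne_zero n) _ _ h]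
  -- Each of the `r` functions absorbs one factor 2.
  have h1 : 2 ^ lam.length * skewSum (xv n) (fun (i : Fin lam.length) p =>
      (∏ m ∈ Finset.range (lam.getD i 0), (xv n p - shiftZero (fun j => -tv n j) m)) *
        pfWeight Finset.univ (xv n) p) =
      skewSum (xv n) (fun (i : Fin lam.length) => evalC n (lam.get i)) := by
    rw [skewSum, skewSum, Finset.mul_sum]
    refine Finset.sum_congr rfl fun σ _ => ?_
    simp only [evalC, hget]
    rw [Finset.prod_mul_distrib (f := fun _ => (2 : RatXT n)), Finset.prod_const, Finset.card_univ,
      Fintype.card_fin, mul_assoc]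
  rw [h1, ← pfaffianExt_skewForm _ (xv_add_xv_ne_zero n), QQ]
  refine (map_pfaffianExt (R := MvPolynomial ℕ Gam) (S := RatXT n) (realizeC n) _ _ _).trans ?_
  congr 1
  · ext i j
    exact realizeC_QQ2 _ _ (hp i) (hp j)
  · funext i
    simpa using realizeC_q_add (n := n) _ 0 (hp i)

theorem realizeD_RR (n : ℕ) (hn : Even n) (lam : List ℕ) (hlam : Even lam.length) :
    realizeD n (RR lam) =
      skewSum (xv n) (fun (i : Fin lam.length) => evalD n (lam.getD i 0)) := by
  have hget : ∀ i : Fin lam.length, lam.getD i 0 = lam.get i := fun i => by simp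
  rw [RR, ← pfaffian_skewForm _ (xv_add_xv_ne_zero n) hlam]
  refine (map_pfaffian (R := MvPolynomial ℕ GamD) (S := RatXT n) (realizeD n) _ _).trans ?_
  congr 1
  ext i j
  change realizeD n (RR2 (lam.get i) (lam.get j)) =
    skewForm (xv n) (evalD n (lam.getD i 0)) (evalD n (lam.getD j 0))
  rw [hget, hget, realizeD_RR2 hn]

theorem underlying_eq_or (lam : List ℕ) (h : IsTypeDPartition lam) :
    underlying lam = lam ∨ lam = underlying lam ++ [0] := by
  induction lam with
  | nil => simp [underlying]
  | cons a l ih =>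
    obtain ⟨ha, hl⟩ := List.pairwise_cons.1 h
    obtain _ | a := a
    · cases l with
      | nil => right; simp [underlying]
      | cons b l => exact absurd (ha b (by simp)) (by simp)
    · have e : underlying ((a + 1) :: l) = (a + 1) :: underlying l := by simp [underlying]
      rw [e]
      rcases ih hl with h | h
      · left; rw [h]
      · right; rw [List.cons_append, ← h]

/-- In both types the `n`-variable identities for all admissible `n` together say that the
polynomial is the stable limit of Ivanov's functions (the limit over even `n` in type D). -/
theorem proposition2p4 :
    (∀ lam : List ℕ, IsStrictPartition lam → ∀ n : ℕ, lam.length ≤ n →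
      realizeC n (QQ lam) = factorialQ n (xv n) (fun j => -tv n j) lam) ∧
    (∀ lam : List ℕ, IsTypeDPartition lam → Even lam.length →
      ∀ n : ℕ, Even n → (underlying lam).length ≤ n →
        realizeD n (RR lam) = factorialP n (xv n) (fun j => -tv n j) (underlying lam)) := by
  refine ⟨fun lam hlam n h => realizeC_QQ n lam hlam.2 h, fun lam hlam heven n hn h => ?_⟩
  rw [realizeD_RR n hn lam heven,
    factorialP_eq_skewSum n _ (xv_injective n) (xv_add_xv_ne_zero n) _ _ h]
  rcases underlying_eq_or lam hlam with e | e
  · rw [e]; rfl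
  -- The final part 0 has an empty factorial power, so its function is the bare weight and it can be
  -- summed out.
  · generalize underlying lam = mu at *
    subst e
    have hodd : Odd mu.length := by
      rw [List.length_append, List.length_singleton, Nat.even_add_one, Nat.not_even_iff_odd] at heven
      exact heven
    rw [List.length_append, List.length_singleton,
      skewSum_snoc_pfWeight (xv n) (xv_injective n) (xv_add_xv_ne_zero n) (by simpa using hn) hodd]
    · congr 1
      funext i p
      simp [evalD]
    · funext p
      simp [evalD]
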